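/- Let $k\ge 2$ and $d\ge 2$ be integers. A family $x_1,\dots,x_m$ of (not necessarily distinct) vectors in a real normed space $X$ is called $k$-collapsing if $\bigl\|\sum_{i\in I}x_i\bigr\|\le 1$ for every $I\subseteq\{1,\dots,m\}$ with exactly $k$ elements. For a $d$-dimensional real normed space $X$, let $\mathcal{C}_k(X)$ be the largest $m$ for which $X$ contains a $k$-collapsing family of $m$ vectors, each of norm at least $1$, and let $$\overline{\mathcal{C}}(k,d)=\max\{\mathcal{C}_k(X) : X \text{ is a } d\text{-dimensional real normed space}\}.$$ Then this maximum is finite and $$\overline{\mathcal{C}}(k,d)=\max\{k+1,\,2d\}$$ in each of the following cases: (1) $d=2$ and $k\ge 2$; (2) $d\in\{3,4,5\}$ and $k\ge 3$; (3) $d=6$ and either $3\le k\le 10$ or $k\ge 17$; (4) $d=7$ and either $3\le k\le 12$ or $k\ge 41$. -/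

import Mathlib

universe u

/-- A family `x` of `m` (not necessarily distinct) vectors of a real normed space satisfies the
`k`-collapsing condition if every sum of `k` members of the family, taken over a `k`-element set
of indices, has norm at most `1`. -/
def IsCollapsing {X : Type u} [NormedAddCommGroup X] [NormedSpace ℝ X] (k : ℕ) {m : ℕ}
    (x : Fin m → X) : Prop :=
  ∀ I : Finset (Fin m), I.card = k → ‖∑ i ∈ I, x i‖ ≤ 1

/-- The set of all `m` for which `X` contains a `k`-collapsing family of `m` vectors of norm at
least `1`. -/
def collapsingSizes (k : ℕ) (X : Type u) [NormedAddCommGroup X] [NormedSpace ℝ X] : Set ℕ :=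
  {m | ∃ x : Fin m → X, (∀ i, 1 ≤ ‖x i‖) ∧ IsCollapsing k x}

/-- `C_k(X)`: the largest `m` for which `X` contains a `k`-collapsing family of `m` vectors of norm
at least `1`, with the value `∞` if there is no largest such `m`. -/
noncomputable def collapsingNumber (k : ℕ) (X : Type u) [NormedAddCommGroup X] [NormedSpace ℝ X] :
    ℕ∞ :=
  sSup ((fun m : ℕ => (m : ℕ∞)) '' collapsingSizes k X)

/-- The set of the values `C_k(X)`, where `X` ranges over all `d`-dimensional real normed spaces
(which are automatically complete). -/
def collapsingNumbers (k d : ℕ) : Set ℕ∞ :=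
  {c | ∃ (X : Type u) (_ : NormedAddCommGroup X) (_ : NormedSpace ℝ X),
    FiniteDimensional ℝ X ∧ Module.finrank ℝ X = d ∧ c = collapsingNumber k X}

/-- `C̄(k, d)`: the maximum of `C_k(X)` over all `d`-dimensional real normed spaces `X`, with the
value `∞` if the numbers `C_k(X)` are not bounded by a natural number. -/
noncomputable def maxCollapsingNumber (k d : ℕ) : ℕ∞ :=
  sSup (collapsingNumbers.{u} k d)

/-- A finite value of `C_k(X)` is an attained maximum. -/
theorem isGreatest_of_collapsingNumber_eq {k n : ℕ} {X : Type u} [NormedAddCommGroup X]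
    [NormedSpace ℝ X] (h : collapsingNumber k X = (n : ℕ∞)) :
    IsGreatest (collapsingSizes k X) n := by
  have hne : ((fun m : ℕ => (m : ℕ∞)) '' collapsingSizes k X).Nonempty := by
    refine ⟨_, 0, ⟨fun i => i.elim0, fun i => i.elim0, fun I _ => ?_⟩, rfl⟩
    rw [Finset.eq_empty_of_isEmpty I]
    simp
  have := hne.to_subtype
  have hmem := ENat.sSup_mem_of_nonempty_of_lt_top
    (lt_of_eq_of_lt h (ENat.natCast_lt_top n))
  change collapsingNumber k X ∈ _ at hmem
  rw [h] at hmem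
  obtain ⟨m, hm, hmn⟩ := hmem
  refine ⟨by rwa [← Nat.cast_injective hmn], fun j hj => ?_⟩
  have hle : (j : ℕ∞) ≤ collapsingNumber k X := le_sSup ⟨j, hj, rfl⟩
  rw [h] at hle
  exact_mod_cast hle

/-- A finite value of `C̄(k, d)` is an attained maximum. -/
theorem isGreatest_of_maxCollapsingNumber_eq {k d n : ℕ}
    (h : maxCollapsingNumber.{u} k d = (n : ℕ∞)) :
    IsGreatest (collapsingNumbers.{u} k d) n := by
  have hne : (collapsingNumbers.{u} k d).Nonempty :=
    ⟨_, EuclideanSpace ℝ (ULift.{u} (Fin d)), inferInstance, inferInstance, inferInstance,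
      by simp, rfl⟩
  have := hne.to_subtype
  have hmem := ENat.sSup_mem_of_nonempty_of_lt_top
    (lt_of_eq_of_lt h (ENat.natCast_lt_top n))
  change maxCollapsingNumber k d ∈ _ at hmem
  rw [h] at hmem
  refine ⟨hmem, fun c hc => ?_⟩
  rw [← h]
  exact le_sSup hc

/-! For the upper bound, take norming functionals scaled so that `f i (x i) = 1`, and consider the
matrix `f i (x j)`. Its diagonal is 1 and its rank is at most `d`, so `sq_sum_diag_le_finrank_mul`
makes its entries large in square sum. Collapsing makes them small: off the diagonal of a row, any
`k - 1` entries sum to at most 0 and any `k` to at least -1. Sorted rows of this kind form a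
simplex, so the convex function `∑ (b j + c) ^ 2` need only be checked at its vertices, which are
step vectors (`sum_add_sq_le`). `mul_sq_le_of_isCollapsing` compares the two estimates. For `k ≤ 2d
- 2` a shift `c > 0` is used, costing one dimension; for larger `k`, `c = 0`. The lower bound comes
from explicit families in the sup norm. -/

/-! ### Trace and rank -/

open Finset in
/-- The trace inequality `(tr A)² ≤ rank A · ‖A‖²` for a matrix whose columns are the images
of vectors of a finite-dimensional space. -/
theorem sq_sum_diag_le_finrank_mul {ι Y : Type*} [Fintype ι] [AddCommGroup Y] [Module ℝ Y]
    [FiniteDimensional ℝ Y] (L : Y →ₗ[ℝ] EuclideanSpace ℝ ι) (y : ι → Y) :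
    (∑ j, L (y j) j) ^ 2 ≤ Module.finrank ℝ Y * ∑ j, ∑ i, (L (y j) i) ^ 2 := by
  classical
  let W := LinearMap.range L
  let u := stdOrthonormalBasis ℝ W
  let v : ι → W := fun j => ⟨L (y j), LinearMap.mem_range_self L _⟩
  have hv (j i : ι) : L (y j) i = ∑ l, inner ℝ (u l) (v j) * (u l : EuclideanSpace ℝ ι) i := by
    have h := congrArg (fun z : W => (z : EuclideanSpace ℝ ι) i) (u.sum_repr' (v j))
    simpa [v] using h.symm
  have hnorm (j : ι) : ∑ i, (L (y j) i) ^ 2 = ∑ l, (inner ℝ (u l) (v j)) ^ 2 := by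
    have h1 := u.sum_sq_norm_inner_right (v j)
    have h2 : ‖v j‖ ^ 2 = ∑ i, (L (y j) i) ^ 2 := by
      rw [Submodule.coe_norm, EuclideanSpace.norm_sq_eq]
      simp [v]
    rw [← h2, ← h1]
    simp
  have hu (l) : ∑ i, ((u l : EuclideanSpace ℝ ι) i) ^ 2 = 1 := by
    have h1 : ‖u l‖ ^ 2 = 1 := by simp
    rw [Submodule.coe_norm, EuclideanSpace.norm_sq_eq] at h1
    simpa using h1
  have hcard : ∑ l, ∑ j, ((u l : EuclideanSpace ℝ ι) j) ^ 2 ≤ Module.finrank ℝ Y := by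
    simp only [hu]
    simpa using LinearMap.finrank_range_le L
  -- In the orthonormal basis `u` of the range, the trace is an inner product of two families
  -- indexed by `(l, j)`; the squares of the first sum to the rank.
  have hcs := Finset.sum_mul_sq_le_sq_mul_sq (univ : Finset (Fin (Module.finrank ℝ W) × ι))
    (fun z => (u z.1 : EuclideanSpace ℝ ι) z.2) (fun z => inner ℝ (u z.1) (v z.2))
  simp only [Fintype.sum_prod_type] at hcs
  calc (∑ j, L (y j) j) ^ 2
      = (∑ l, ∑ j, (u l : EuclideanSpace ℝ ι) j * inner ℝ (u l) (v j)) ^ 2 := by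
        rw [Finset.sum_comm]
        simp only [hv, mul_comm]
    _ ≤ _ := hcs
    _ ≤ Module.finrank ℝ Y * ∑ l, ∑ j, (inner ℝ (u l) (v j)) ^ 2 := by
        gcongr
    _ = _ := by
        rw [Finset.sum_comm]
        simp only [hnorm]

/-! ### Convexity: reduction of row bounds to step vectors -/

/-- The vector of length `n` with the value `s` in the first `p` places and the value `r`
thereafter. -/
noncomputable def stepVector (s r : ℕ → ℝ) (p j : ℕ) : ℝ := if j < p then s p else r p

open Finset in
-- The `n - 1` monotonicity constraints and the two sum constraints cut out a simplex in dimension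
-- `n`. Dropping one monotonicity constraint gives the step vector with its jump there; dropping a
-- sum constraint gives the constant `-1 / k` (index `p = 0`) or the zero vector, which carries the
-- weight missing from 1.
theorem exists_weights_stepVector {n k : ℕ} (hk : 2 ≤ k) (hkn : k + 1 ≤ n) {s r b : ℕ → ℝ}
    (hb : ∀ j, j + 1 < n → b (j + 1) ≤ b j)
    (htop : ∑ j ∈ range (k - 1), b j ≤ 0) (hbot : -1 ≤ ∑ j ∈ Ico (n - k) n, b j)
    (hrs : ∀ p ∈ Ico 1 n, r p < s p)
    (hsumtop : ∀ p ∈ Ico 1 n, ∑ j ∈ range (k - 1), stepVector s r p j = 0)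
    (hsumbot : ∀ p ∈ Ico 1 n, ∑ j ∈ Ico (n - k) n, stepVector s r p j = -1)
    (hr : r 0 = -1 / k) :
    ∃ w : ℕ → ℝ, (∀ p ∈ range n, 0 ≤ w p) ∧ ∑ p ∈ range n, w p ≤ 1 ∧
      ∀ j < n, b j = ∑ p ∈ range n, w p * stepVector s r p j := by
  -- Only the step vector with index `p` jumps at `p`, so the jumps of `b` force these weights, and
  -- the remainder `g` is constant.
  let v : ℕ → ℝ := fun p => (b (p - 1) - b p) / (s p - r p)
  let g : ℕ → ℝ := fun j => b j - ∑ p ∈ Ico 1 n, v p * stepVector s r p j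
  have hk0 : (0 : ℝ) < k := by positivity
  have hk1 : (0 : ℝ) < (k - 1 : ℕ) := by exact_mod_cast (by omega : 0 < k - 1)
  have hg (j : ℕ) (hj : j < n) : g j = g 0 := by
    induction j with
    | zero => rfl
    | succ j ih =>
      rw [← ih (by omega)]
      have hmem : j + 1 ∈ Ico 1 n := by simp [hj]
      have hdiff : ∑ p ∈ Ico 1 n, (v p * stepVector s r p j - v p * stepVector s r p (j + 1)) =
          b j - b (j + 1) := by
        rw [Finset.sum_eq_single_of_mem (j + 1) hmem]
        · have := hrs _ hmem
          have h0 : s (j + 1) - r (j + 1) ≠ 0 := by linarith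
          simp only [v, stepVector, add_tsub_cancel_right, lt_add_iff_pos_right, zero_lt_one,
            if_true, lt_irrefl, if_false, ← mul_sub]
          field_simp
        · intro p _ hp
          have : j < p ↔ j + 1 < p := by omega
          simp [stepVector, this]
      rw [Finset.sum_sub_distrib] at hdiff
      simp only [g]
      linarith
  have hbg (j : ℕ) (hj : j < n) : b j = g 0 + ∑ p ∈ Ico 1 n, v p * stepVector s r p j := by
    rw [← hg j hj]
    simp [g]
  have hsum (J : Finset ℕ) (hJ : ∀ j ∈ J, j < n) : ∑ j ∈ J, b j =
      #J * g 0 + ∑ p ∈ Ico 1 n, v p * ∑ j ∈ J, stepVector s r p j := by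
    rw [Finset.sum_congr rfl fun j hj => hbg j (hJ j hj), Finset.sum_add_distrib,
      Finset.sum_comm]
    simp [Finset.mul_sum]
  rw [hsum _ (by simp; omega), Finset.sum_congr rfl fun p hp => by rw [hsumtop p hp]] at htop
  rw [hsum _ (by simp), Finset.sum_congr rfl fun p hp => by rw [hsumbot p hp]] at hbot
  simp only [mul_zero, sum_const_zero, add_zero, card_range] at htop
  have hg0 : g 0 ≤ 0 := by
    by_contra! h
    exact absurd htop (not_le.2 (mul_pos hk1 h))
  have hcard : #(Ico (n - k) n) = k := by simp; omega
  rw [hcard] at hbot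
  simp only [mul_neg, mul_one, sum_neg_distrib] at hbot
  let w : ℕ → ℝ := fun p => if p = 0 then -k * g 0 else v p
  have hn : 0 < n := by omega
  have hwv : ∀ p ∈ Ico 1 n, w p = v p := by
    intro p hp
    have : p ≠ 0 := by have := (mem_Ico.1 hp).1; omega
    simp [w, this]
  have hsplit (f : ℕ → ℝ) : ∑ p ∈ range n, f p = f 0 + ∑ p ∈ Ico 1 n, f p := by
    rw [range_eq_Ico, Finset.sum_eq_sum_Ico_succ_bot hn]
  refine ⟨w, ?_, ?_, ?_⟩
  · intro p hp
    by_cases h0 : p = 0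
    · simp only [w, h0, if_true]
      nlinarith
    · have hp' : p ∈ Ico 1 n := by simp at hp ⊢; omega
      rw [hwv p hp']
      have h1 := hb (p - 1) (by simp at hp; omega)
      rw [Nat.sub_add_cancel (by omega)] at h1
      have h2 := hrs p hp'
      exact div_nonneg (by linarith) (by linarith)
  · rw [hsplit, Finset.sum_congr rfl hwv]
    simp only [w, if_true]
    linarith
  · intro j hj
    have hwv' : ∀ p ∈ Ico 1 n, w p * stepVector s r p j = v p * stepVector s r p j :=
      fun p hp => by rw [hwv p hp]
    rw [hbg j hj, hsplit, Finset.sum_congr rfl hwv']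
    simp only [w, if_true, stepVector, not_lt_zero, if_false, hr]
    field_simp

open Finset in
theorem sum_stepVector_sq {n p : ℕ} (hp : p ≤ n) (s r : ℕ → ℝ) (c : ℝ) :
    ∑ j ∈ range n, (stepVector s r p j + c) ^ 2 =
      p * (s p + c) ^ 2 + (n - p : ℕ) * (r p + c) ^ 2 := by
  rw [← Finset.sum_range_add_sum_Ico _ hp,
    Finset.sum_congr (s₁ := range p) rfl fun j hj => by
      rw [stepVector, if_pos (mem_range.1 hj)],
    Finset.sum_congr (s₁ := Ico p n) rfl fun j hj => by
      rw [stepVector, if_neg (not_lt.2 (mem_Ico.1 hj).1)]]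
  simp

/-- Jensen's inequality for `t ↦ (t + c) ^ 2`, with the missing mass placed at `t = 0`; the defect
is a variance. -/
theorem sum_mul_add_sq_le {ι : Type*} (S : Finset ι) (w a : ι → ℝ) (c : ℝ)
    (hw : ∀ p ∈ S, 0 ≤ w p) (hw1 : ∑ p ∈ S, w p ≤ 1) :
    (∑ p ∈ S, w p * a p + c) ^ 2 ≤
      ∑ p ∈ S, w p * (a p + c) ^ 2 + (1 - ∑ p ∈ S, w p) * c ^ 2 := by
  set x := ∑ p ∈ S, w p * a p + c
  have hx : ∑ p ∈ S, w p * (a p + c) + (1 - ∑ p ∈ S, w p) * c = x := by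
    simp only [mul_add, Finset.sum_add_distrib, ← Finset.sum_mul, x]
    ring
  have h : 0 ≤ ∑ p ∈ S, w p * (a p + c - x) ^ 2 + (1 - ∑ p ∈ S, w p) * (c - x) ^ 2 :=
    add_nonneg (Finset.sum_nonneg fun p hp => mul_nonneg (hw p hp) (sq_nonneg _))
      (mul_nonneg (by linarith) (sq_nonneg _))
  have h2 : ∑ p ∈ S, w p * (a p + c - x) ^ 2 = ∑ p ∈ S, w p * (a p + c) ^ 2
      - 2 * x * ∑ p ∈ S, w p * (a p + c) + x ^ 2 * ∑ p ∈ S, w p := by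
    rw [Finset.mul_sum, Finset.mul_sum, ← Finset.sum_sub_distrib, ← Finset.sum_add_distrib]
    exact Finset.sum_congr rfl fun p _ => by ring
  rw [h2] at h
  have h3 : ∑ p ∈ S, w p * (a p + c) = x - (1 - ∑ p ∈ S, w p) * c := by linarith
  rw [h3] at h
  nlinarith

open Finset in
/-- A convexity bound for vectors all of whose sums of `k - 1` entries are nonpositive and all of
whose sums of `k` entries are at least `-1`: these are dominated by step vectors. -/
theorem sum_add_sq_le_of_stepVector {n k : ℕ} (hk : 2 ≤ k) (hkn : k + 1 ≤ n) {s r : ℕ → ℝ}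
    (hrs : ∀ p ∈ Ico 1 n, r p < s p)
    (hsumtop : ∀ p ∈ Ico 1 n, ∑ j ∈ range (k - 1), stepVector s r p j = 0)
    (hsumbot : ∀ p ∈ Ico 1 n, ∑ j ∈ Ico (n - k) n, stepVector s r p j = -1)
    (hr : r 0 = -1 / k) {c M : ℝ}
    (hM : ∀ p ∈ range n, p * (s p + c) ^ 2 + (n - p : ℕ) * (r p + c) ^ 2 ≤ M)
    (hc : n * c ^ 2 ≤ M) {b : Fin n → ℝ}
    (htop : ∀ J : Finset (Fin n), #J = k - 1 → ∑ j ∈ J, b j ≤ 0)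
    (hbot : ∀ J : Finset (Fin n), #J = k → -1 ≤ ∑ j ∈ J, b j) :
    ∑ j, (b j + c) ^ 2 ≤ M := by
  let σ := Tuple.sort (fun j => -b j)
  let β : ℕ → ℝ := fun j => if h : j < n then b (σ ⟨j, h⟩) else 0
  have hβ (i : Fin n) : b (σ i) = β i := by simp [β]
  have hanti : ∀ j, j + 1 < n → β (j + 1) ≤ β j := by
    intro j hj
    have h := Tuple.monotone_sort (fun j => -b j)
      (show (⟨j, by omega⟩ : Fin n) ≤ ⟨j + 1, hj⟩ from by simp)
    simp only [Function.comp] at h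
    simp only [β, hj, show j < n by omega, dif_pos]
    simpa [σ] using h
  have hsum (J : Finset ℕ) (hJ : ∀ j ∈ J, j < n) :
      ∃ I : Finset (Fin n), #I = #J ∧ ∑ i ∈ I, b i = ∑ j ∈ J, β j := by
    refine ⟨(J.attachFin hJ).map σ.toEmbedding, by simp, ?_⟩
    rw [Finset.sum_map]
    refine Finset.sum_bij (fun i _ => (i : ℕ)) ?_ ?_ ?_ ?_
    · simp
    · intro a _ b _ h
      exact Fin.ext h
    · intro j hj
      exact ⟨⟨j, hJ j hj⟩, by simpa using hj, rfl⟩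
    · intro i _
      exact hβ i
  have ht : ∑ j ∈ range (k - 1), β j ≤ 0 := by
    obtain ⟨I, hI, h⟩ := hsum (range (k - 1)) (by simp; omega)
    rw [← h]
    exact htop I (by simpa using hI)
  have hb : -1 ≤ ∑ j ∈ Ico (n - k) n, β j := by
    obtain ⟨I, hI, h⟩ := hsum (Ico (n - k) n) (by simp)
    rw [← h]
    refine hbot I (hI.trans ?_)
    simp
    omega
  obtain ⟨w, hw, hw1, hwβ⟩ :=
    exists_weights_stepVector hk hkn hanti ht hb hrs hsumtop hsumbot hr
  calc ∑ j, (b j + c) ^ 2 = ∑ j : Fin n, (b (σ j) + c) ^ 2 :=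
        (Equiv.sum_comp σ fun j => (b j + c) ^ 2).symm
    _ = ∑ j ∈ range n, (β j + c) ^ 2 := by
        simp only [hβ]
        exact Fin.sum_univ_eq_sum_range (fun j => (β j + c) ^ 2) n
    _ ≤ ∑ j ∈ range n, (∑ p ∈ range n, w p * (stepVector s r p j + c) ^ 2
          + (1 - ∑ p ∈ range n, w p) * c ^ 2) := by
        refine Finset.sum_le_sum fun j hj => ?_
        rw [hwβ j (mem_range.1 hj)]
        exact sum_mul_add_sq_le _ _ _ _ hw hw1
    _ = ∑ p ∈ range n, w p * (p * (s p + c) ^ 2 + (n - p : ℕ) * (r p + c) ^ 2)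
          + (1 - ∑ p ∈ range n, w p) * (n * c ^ 2) := by
        rw [Finset.sum_add_distrib, Finset.sum_comm]
        congr 1
        · refine Finset.sum_congr rfl fun p hp => ?_
          rw [← Finset.mul_sum, sum_stepVector_sq (mem_range.1 hp).le]
        · simp
          ring
    _ ≤ ∑ p ∈ range n, w p * M + (1 - ∑ p ∈ range n, w p) * M := by
        refine add_le_add (Finset.sum_le_sum fun p hp => ?_) ?_
        · exact mul_le_mul_of_nonneg_left (hM p hp) (hw p hp)
        · exact mul_le_mul_of_nonneg_left hc (by linarith)
    _ = M := by
        rw [← Finset.sum_mul]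
        ring

open Finset in
theorem sum_range_stepVector (s r : ℕ → ℝ) (p N : ℕ) :
    ∑ j ∈ range N, stepVector s r p j = min p N * s p + (N - min p N) * r p := by
  have h : min p N ≤ N := min_le_right _ _
  rw [← Finset.sum_range_add_sum_Ico _ h,
    Finset.sum_congr (s₁ := range (min p N)) rfl fun j hj => by
      rw [stepVector, if_pos (lt_of_lt_of_le (mem_range.1 hj) (min_le_left _ _))],
    Finset.sum_congr (s₁ := Ico (min p N) N) rfl fun j hj => by
      rw [stepVector, if_neg (by simp at hj; omega)]]
  simp [Nat.cast_sub h]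

/-- The larger entry of the extreme step vectors, as a numerator over `stepDen`. -/
def stepNum (k p : ℕ) : ℤ := k - 1 - (min p (k - 1) : ℕ)

/-- The common denominator of the entries of the extreme step vectors. -/
def stepDen (n k p : ℕ) : ℤ :=
  (min p (k - 1) : ℕ) * (min (n - p) k : ℕ) - stepNum k p * (k - (min (n - p) k : ℕ))

theorem stepDen_pos {n k p : ℕ} (hk : 2 ≤ k) (hkn : k + 1 ≤ n) (hp : 1 ≤ p) (hpn : p < n) :
    0 < stepDen n k p := by
  unfold stepDen stepNum
  rcases le_total p (k - 1) with h1 | h1 <;> rcases le_total (n - p) k with h2 | h2 <;>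
    simp only [h1, h2, min_eq_left, min_eq_right]
  -- Here the denominator equals `p + (k - 1) * (n - k)`.
  · push_cast [hpn.le]
    have h1' : (p : ℤ) ≤ k - 1 := by omega
    have h2' : (n : ℤ) - p ≤ k := by omega
    zify at hk hkn hp hpn
    nlinarith
  · have : (0 : ℤ) < p * k := by positivity
    simpa using this
  · push_cast [hpn.le, show 1 ≤ k by omega]
    have : (0 : ℤ) < (k - 1) * (n - p) := mul_pos (by omega) (by omega)
    linarith
  · push_cast [show 1 ≤ k by omega]
    have : (0 : ℤ) < (k - 1) * k := mul_pos (by omega) (by omega)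
    linarith

open Finset in
/-- A vector of length `n ≥ k + 1` all of whose sums of `k - 1` entries are nonpositive and all of
whose sums of `k` entries are at least `-1` satisfies every bound on the squared distance to a
constant vector that holds for the extreme step vectors. -/
theorem sum_add_sq_le {n k : ℕ} (hk : 2 ≤ k) (hkn : k + 1 ≤ n) {c M : ℝ}
    (hM : ∀ p, 1 ≤ p → p < n → p * (stepNum k p + c * stepDen n k p) ^ 2 +
      (n - p) * (c * stepDen n k p - (min p (k - 1) : ℕ)) ^ 2 ≤ M * (stepDen n k p : ℝ) ^ 2)
    (hM0 : n * (c - 1 / k) ^ 2 ≤ M) (hc : n * c ^ 2 ≤ M) {b : Fin n → ℝ}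
    (htop : ∀ J : Finset (Fin n), #J = k - 1 → ∑ j ∈ J, b j ≤ 0)
    (hbot : ∀ J : Finset (Fin n), #J = k → -1 ≤ ∑ j ∈ J, b j) :
    ∑ j, (b j + c) ^ 2 ≤ M := by
  have hkR : (2 : ℝ) ≤ k := by exact_mod_cast hk
  have hk1 : ((k - 1 : ℕ) : ℝ) = k - 1 := by push_cast [show 1 ≤ k by omega]; rfl
  let s : ℕ → ℝ := fun p => stepNum k p / stepDen n k p
  -- `stepDen n k 0` vanishes, so the constant vertex is entered by hand.
  let r : ℕ → ℝ := fun p => if p = 0 then -1 / k else -((min p (k - 1) : ℕ) : ℝ) / stepDen n k p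
  have hr (p : ℕ) (hp : 1 ≤ p) : r p = -((min p (k - 1) : ℕ) : ℝ) / stepDen n k p :=
    if_neg (by omega)
  have hD (p : ℕ) (hp : 1 ≤ p) (hpn : p < n) : (0 : ℝ) < stepDen n k p := by
    exact_mod_cast stepDen_pos hk hkn hp hpn
  have hnum (p : ℕ) : (stepNum k p : ℝ) = k - 1 - (min p (k - 1) : ℕ) := by
    simp only [stepNum]
    push_cast
    rfl
  have hden (p : ℕ) : (stepDen n k p : ℝ) = (min p (k - 1) : ℕ) * (min (n - p) k : ℕ) -
      (k - 1 - (min p (k - 1) : ℕ)) * (k - (min (n - p) k : ℕ)) := by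
    rw [← hnum]
    simp only [stepDen, Int.cast_sub, Int.cast_mul, Int.cast_natCast]
  refine sum_add_sq_le_of_stepVector (s := s) (r := r) hk hkn ?_ ?_ ?_ (if_pos rfl) ?_ hc htop hbot
  · intro p hp
    obtain ⟨hp1, hpn⟩ := mem_Ico.1 hp
    have hp1R : (1 : ℝ) ≤ p := by exact_mod_cast hp1
    rw [hr p hp1]
    refine div_lt_div_of_pos_right ?_ (hD p hp1 hpn)
    have h1 : (1 : ℝ) ≤ (min p (k - 1) : ℕ) := by
      exact_mod_cast (by omega : 1 ≤ min p (k - 1))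
    have h2 : ((min p (k - 1) : ℕ) : ℝ) ≤ k - 1 := by
      rw [← hk1]
      exact_mod_cast min_le_right _ _
    rw [hnum]
    linarith
  · intro p hp
    obtain ⟨hp1, hpn⟩ := mem_Ico.1 hp
    have := (hD p hp1 hpn).ne'
    rw [sum_range_stepVector, hr p hp1, hk1]
    simp only [s, hnum]
    field_simp
    ring
  · intro p hp
    obtain ⟨hp1, hpn⟩ := mem_Ico.1 hp
    have h0 := (hD p hp1 hpn).ne'
    have hkn' : ((n - k : ℕ) : ℝ) = n - k := by push_cast [show k ≤ n by omega]; rfl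
    have hmin : ((min p (n - k) : ℕ) : ℝ) = p - k + (min (n - p) k : ℕ) := by
      have : min p (n - k) + k = p + min (n - p) k := by omega
      have : ((min p (n - k) : ℕ) : ℝ) + k = p + (min (n - p) k : ℕ) := by exact_mod_cast this
      linarith
    rw [Finset.sum_Ico_eq_sub _ (by omega : n - k ≤ n), sum_range_stepVector,
      sum_range_stepVector, hkn', hmin, min_eq_left hpn.le, hr p hp1]
    simp only [s, hnum]
    field_simp
    rw [hden]
    ring
  · intro p hp
    have hpn := mem_range.1 hp
    rcases Nat.eq_zero_or_pos p with rfl | hp1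
    · simp only [r, if_true, Nat.cast_zero, zero_mul, zero_add, Nat.sub_zero]
      convert hM0 using 2
      ring
    · have h0 := hD p hp1 hpn
      rw [hr p hp1, Nat.cast_sub hpn.le]
      refine le_of_mul_le_mul_right ((le_of_eq ?_).trans (hM p hp1 hpn)) (pow_pos h0 2)
      have h0' := h0.ne'
      simp only [s]
      field_simp
      ring

/-! ### Row bounds in the two ranges of `k` -/

open Finset in
theorem sum_sq_le_of_length_eq {k : ℕ} (hk : 3 ≤ k) {b : Fin (k + 1) → ℝ}
    (htop : ∀ J : Finset (Fin (k + 1)), #J = k - 1 → ∑ j ∈ J, b j ≤ 0)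
    (hbot : ∀ J : Finset (Fin (k + 1)), #J = k → -1 ≤ ∑ j ∈ J, b j) :
    ∑ j, (b j + 0) ^ 2 ≤ max 1 ((k - 1 : ℝ) ^ 2 / (8 * (k - 2))) := by
  have hkR : (3 : ℝ) ≤ k := by exact_mod_cast hk
  refine sum_add_sq_le (by omega) le_rfl ?_ ?_ ?_ htop hbot
  · intro p hp hpk
    have hpR : (1 : ℝ) ≤ p := by exact_mod_cast hp
    rcases Nat.lt_succ_iff_lt_or_eq.1 hpk with h | h
    · have hmin : min p (k - 1) = p := min_eq_left (by omega)
      have hmin' : min (k + 1 - p) k = k + 1 - p := min_eq_left (by omega)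
      have hnum : stepNum k p = k - 1 - p := by rw [stepNum, hmin]
      have hden : stepDen (k + 1) k p = k + p - 1 := by
        rw [stepDen, hmin, hmin', hnum]
        push_cast [hpk.le]
        ring
      rw [hnum, hden, hmin]
      refine le_trans ?_ (mul_le_mul_of_nonneg_right (le_max_right _ _) (sq_nonneg _))
      rw [div_mul_eq_mul_div, le_div_iff₀ (by linarith)]
      push_cast
      -- After clearing denominators the difference of the two sides is exactly this square.
      nlinarith [sq_nonneg ((3 * k - 7) * p - ((k : ℝ) - 1) ^ 2)]
    -- For `p = k` the vertex is `(0, …, 0, -1)`, which accounts for the 1 in the maximum.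
    · subst h
      have hmin : min p (p - 1) = p - 1 := min_eq_right (by omega)
      have hmin' : min (p + 1 - p) p = 1 := by omega
      have hnum : stepNum p p = 0 := by
        rw [stepNum, hmin]
        push_cast [hp]
        ring
      have hden : stepDen (p + 1) p p = p - 1 := by
        rw [stepDen, hmin, hmin', hnum]
        push_cast [hp]
        ring
      rw [hnum, hden, hmin, Nat.cast_sub hp]
      refine le_trans (le_of_eq ?_) (mul_le_mul_of_nonneg_right (le_max_left _ _) (sq_nonneg _))
      push_cast
      ring
  · refine le_trans ?_ (le_max_left _ _)
    rw [zero_sub, neg_sq, div_pow, one_pow, mul_one_div, div_le_one (by positivity)]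
    push_cast
    nlinarith
  · refine le_trans ?_ (le_max_left _ _)
    simp

set_option synthInstance.maxSize 100000 in
set_option synthInstance.maxHeartbeats 400000 in
set_option maxRecDepth 100000 in
theorem stepVector_bound_of_lt_eight : ∀ d < 8, ∀ k < 13, 2 ≤ k → k ≤ 2 * d - 2 → (3 ≤ d → 3 ≤ k) →
    ∀ p < 2 * d, 1 ≤ p →
      p * ((2 * d + 1) * stepNum k p + 2 * stepDen (2 * d) k p) ^ 2 +
        (2 * d - p) * (2 * stepDen (2 * d) k p - (2 * d + 1) * (min p (k - 1) : ℕ)) ^ 2 ≤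
      (2 * d + 1) ^ 2 * stepDen (2 * d) k p ^ 2 := by
  decide

open Finset in
-- Without a shift the bound 1 fails for small `k`: the constant vector `-1 / k` has square sum `2d
-- / k ^ 2`. The non-constant vertices are a finite check, done by `stepVector_bound_of_lt_eight`
-- after multiplying by `(2d + 1) ^ 2`.
theorem sum_add_sq_le_one {d k : ℕ} (hd : d < 8) (hk : 2 ≤ k) (hkd : k ≤ 2 * d - 2)
    (h3 : 3 ≤ d → 3 ≤ k) {b : Fin (2 * d) → ℝ}
    (htop : ∀ J : Finset (Fin (2 * d)), #J = k - 1 → ∑ j ∈ J, b j ≤ 0)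
    (hbot : ∀ J : Finset (Fin (2 * d)), #J = k → -1 ≤ ∑ j ∈ J, b j) :
    ∑ j, (b j + 2 / (2 * d + 1)) ^ 2 ≤ 1 := by
  have hm : (0 : ℝ) < 2 * d + 1 := by positivity
  refine sum_add_sq_le hk (by omega) ?_ ?_ ?_ htop hbot
  · intro p hp hpd
    have h := stepVector_bound_of_lt_eight d hd k (by omega) hk hkd h3 p hpd hp
    have hR : ((p * ((2 * d + 1) * stepNum k p + 2 * stepDen (2 * d) k p) ^ 2 +
        (2 * d - p) * (2 * stepDen (2 * d) k p - (2 * d + 1) * (min p (k - 1) : ℕ)) ^ 2 : ℤ) : ℝ) ≤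
      ((2 * d + 1) ^ 2 * stepDen (2 * d) k p ^ 2 : ℤ) := by exact_mod_cast h
    push_cast at hR ⊢
    refine le_of_mul_le_mul_right (le_trans (le_of_eq ?_) (hR.trans (le_of_eq ?_)))
      (pow_pos hm 2)
    · field_simp
    · ring
  · have hkR : (0 : ℝ) < k := by positivity
    have h : ((2 * d : ℕ) : ℝ) * (2 * k - (2 * d + 1)) ^ 2 ≤ (2 * d + 1) ^ 2 * k ^ 2 := by
      have h' : ((2 * d : ℕ) : ℤ) * (2 * k - (2 * d + 1)) ^ 2 ≤ (2 * d + 1) ^ 2 * k ^ 2 := by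
        have : k < 13 := by omega
        interval_cases d <;> interval_cases k <;> omega
      exact_mod_cast h'
    have h2 : (2 / (2 * d + 1) - 1 / k : ℝ) = (2 * k - (2 * d + 1)) / ((2 * d + 1) * k) := by
      field_simp
    rw [h2, div_pow, mul_div_assoc', div_le_one (by positivity), mul_pow]
    exact h
  · rw [div_pow, mul_div_assoc', div_le_one (by positivity)]
    push_cast
    nlinarith [sq_nonneg (2 * d - 1 : ℝ)]

/-! ### Upper bounds from norming functionals -/

open Finset in
/-- The normalised norming functionals of a family satisfying the collapsing condition. -/
theorem exists_functionals_of_isCollapsing {X : Type*} [NormedAddCommGroup X] [NormedSpace ℝ X]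
    {k m : ℕ} {x : Fin m → X} (hx : ∀ i, 1 ≤ ‖x i‖) (hc : IsCollapsing k x) :
    ∃ f : Fin m → X →ₗ[ℝ] ℝ, (∀ i, f i (x i) = 1) ∧
      ∀ i (I : Finset (Fin m)), #I = k → |∑ j ∈ I, f i (x j)| ≤ 1 := by
  choose g hg hgx using fun i => exists_dual_vector'' ℝ (x i)
  refine ⟨fun i => ‖x i‖⁻¹ • (g i : X →ₗ[ℝ] ℝ), fun i => ?_, fun i I hI => ?_⟩
  · have : ‖x i‖ ≠ 0 := by linarith [hx i]
    have h := hgx i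
    simp only [RCLike.ofReal_real_eq_id, id] at h
    simp [h, this]
  · have h1 : ‖g i (∑ j ∈ I, x j)‖ ≤ 1 :=
      ((g i).le_opNorm _).trans (mul_le_one₀ (hg i) (norm_nonneg _) (hc I hI))
    have h2 : ‖x i‖⁻¹ ≤ 1 := inv_le_one_of_one_le₀ (hx i)
    have h3 : ∑ j ∈ I, (‖x i‖⁻¹ • (g i : X →ₗ[ℝ] ℝ)) (x j) = ‖x i‖⁻¹ * g i (∑ j ∈ I, x j) := by
      simp [Finset.mul_sum]
    rw [h3, abs_mul, abs_of_nonneg (by positivity)]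
    exact mul_le_one₀ h2 (abs_nonneg _) h1

open Finset in
/-- If a constant `c` added to the entries of the functionals on the vectors of a collapsing family
yields the values of functionals on a space `Y`, then row bounds bound `finrank Y` from below. -/
theorem mul_sq_le_of_isCollapsing {X Y : Type*} [NormedAddCommGroup X] [NormedSpace ℝ X]
    [AddCommGroup Y] [Module ℝ Y] [FiniteDimensional ℝ Y] {k n : ℕ} {c M : ℝ}
    (hk : 2 ≤ k)
    (hrow : ∀ b : Fin n → ℝ, (∀ J : Finset (Fin n), #J = k - 1 → ∑ j ∈ J, b j ≤ 0) →
      (∀ J : Finset (Fin n), #J = k → -1 ≤ ∑ j ∈ J, b j) → ∑ j, (b j + c) ^ 2 ≤ M)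
    {x : Fin (n + 1) → X} (hx : ∀ i, 1 ≤ ‖x i‖) (hc : IsCollapsing k x)
    (y : X → Y) (hy : ∀ f : X →ₗ[ℝ] ℝ, ∃ g : Y →ₗ[ℝ] ℝ, ∀ z, g (y z) = f z + c) :
    (n + 1) * (1 + c) ^ 2 ≤ Module.finrank ℝ Y * ((1 + c) ^ 2 + M) := by
  obtain ⟨f, hf1, hf⟩ := exists_functionals_of_isCollapsing hx hc
  choose g hg using fun i => hy (f i)
  have hb (i : Fin (n + 1)) : ∑ j : Fin n, (f i (x (i.succAbove j)) + c) ^ 2 ≤ M := by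
    refine hrow _ (fun J hJ => ?_) (fun J hJ => ?_)
    · have hi : i ∉ J.map i.succAboveEmb := by simp [Fin.succAbove_ne]
      -- The index `i` itself contributes 1, leaving at most 0 for the other `k - 1` entries.
      have h := hf i (cons i (J.map i.succAboveEmb) hi) (by simp [hJ]; omega)
      rw [Finset.sum_cons, hf1, Finset.sum_map] at h
      have := (abs_le.1 h).2
      simp only [Fin.coe_succAboveEmb] at this
      linarith
    · have h := hf i (J.map i.succAboveEmb) (by simp [hJ])
      rw [Finset.sum_map] at h
      exact (abs_le.1 h).1
  let L : Y →ₗ[ℝ] EuclideanSpace ℝ (Fin (n + 1)) :=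
    (WithLp.linearEquiv 2 ℝ (Fin (n + 1) → ℝ)).symm.toLinearMap ∘ₗ LinearMap.pi g
  have hL (z : X) (i : Fin (n + 1)) : L (y z) i = f i z + c := by
    simp [L, hg]
  have h := sq_sum_diag_le_finrank_mul L (fun j => y (x j))
  simp only [hL, hf1] at h
  rw [Finset.sum_comm] at h
  simp only [sum_const, card_univ, Fintype.card_fin, nsmul_eq_mul] at h
  have hsum : ∑ i : Fin (n + 1), ∑ j : Fin (n + 1), (f i (x j) + c) ^ 2 ≤
      (n + 1) * ((1 + c) ^ 2 + M) := by
    have h1 : ∀ i ∈ (univ : Finset (Fin (n + 1))),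
        ∑ j : Fin (n + 1), (f i (x j) + c) ^ 2 ≤ (1 + c) ^ 2 + M := by
      intro i _
      rw [Fin.sum_univ_succAbove _ i, hf1]
      linarith [hb i]
    refine (Finset.sum_le_card_nsmul _ _ _ h1).trans (le_of_eq ?_)
    simp
    ring
  have h2 := h.trans (mul_le_mul_of_nonneg_left hsum (Nat.cast_nonneg _))
  push_cast at h2
  have hn : (0 : ℝ) < n + 1 := by positivity
  refine le_of_mul_le_mul_left ((le_of_eq ?_).trans (h2.trans (le_of_eq ?_))) hn <;> ring

theorem not_isCollapsing_of_le {X : Type*} [NormedAddCommGroup X] [NormedSpace ℝ X]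
    [FiniteDimensional ℝ X] {k d : ℕ} (hX : Module.finrank ℝ X = d) (hd : d < 8) (hk : 2 ≤ k)
    (hkd : k ≤ 2 * d - 2) (h3 : 3 ≤ d → 3 ≤ k) {x : Fin (2 * d + 1) → X} (hx : ∀ i, 1 ≤ ‖x i‖) :
    ¬IsCollapsing k x := by
  intro hc
  -- The extra coordinate 1 realises the shift by a linear functional. The outcome `d (1 + c) ^ 2 ≤
  -- d + 1` is false for `c = 2 / (2d + 1)`.
  have h := mul_sq_le_of_isCollapsing (Y := X × ℝ) hk
    (fun b htop hbot => sum_add_sq_le_one hd hk hkd h3 htop hbot) hx hc (fun z => (z, 1))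
    (fun f => ⟨f.coprod ((2 / (2 * d + 1) : ℝ) • LinearMap.id), by simp⟩)
  rw [Module.finrank_prod, hX, Module.finrank_self] at h
  have hd0 : (0 : ℝ) ≤ d := by positivity
  have h1 : (1 + 2 / (2 * d + 1) : ℝ) ^ 2 = (2 * d + 3) ^ 2 / (2 * d + 1) ^ 2 := by
    field_simp
    ring
  have h2 : (d : ℝ) * ((2 * d + 3) ^ 2 / (2 * d + 1) ^ 2) ≤ d + 1 := by
    rw [h1] at h
    push_cast at h
    linarith
  rw [mul_div_assoc', div_le_iff₀ (by positivity)] at h2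
  have hd1 : (1 : ℝ) ≤ d := by exact_mod_cast (by omega : 1 ≤ d)
  nlinarith

theorem not_isCollapsing_of_lt {X : Type*} [NormedAddCommGroup X] [NormedSpace ℝ X]
    [FiniteDimensional ℝ X] {k d : ℕ} (hX : Module.finrank ℝ X = d) (hk : 3 ≤ k)
    (hkd : 2 * d ≤ k + 1) (h : (d * (k - 1) ^ 2 : ℤ) < 8 * (k - 2) * (k + 2 - d))
    {x : Fin (k + 2) → X} (hx : ∀ i, 1 ≤ ‖x i‖) : ¬IsCollapsing k x := by
  intro hc
  have hkR : (3 : ℝ) ≤ k := by exact_mod_cast hk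
  have h1 := mul_sq_le_of_isCollapsing (Y := X) (by omega : 2 ≤ k)
    (fun b htop hbot => sum_sq_le_of_length_eq hk htop hbot) hx hc id (fun f => ⟨f, by simp⟩)
  rw [hX] at h1
  have h2 : (d * (k - 1) ^ 2 : ℝ) < 8 * (k - 2) * (k + 2 - d) := by exact_mod_cast h
  have h3 : (2 * d : ℝ) ≤ k + 1 := by exact_mod_cast hkd
  push_cast at h1
  rcases le_total (1 : ℝ) ((k - 1 : ℝ) ^ 2 / (8 * (k - 2))) with h4 | h4
  · rw [max_eq_right h4] at h1
    have h5 : (d : ℝ) * ((k - 1 : ℝ) ^ 2 / (8 * (k - 2))) < k + 2 - d := by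
      rw [mul_div_assoc', div_lt_iff₀ (by linarith)]
      linarith
    linarith
  · rw [max_eq_left h4] at h1
    linarith

/-! ### Extremal families in the sup norm -/

theorem card_mem_collapsingSizes {X ι : Type*} [NormedAddCommGroup X] [NormedSpace ℝ X]
    [Fintype ι] {k : ℕ} (x : ι → X) (hx : ∀ i, 1 ≤ ‖x i‖)
    (hc : ∀ I : Finset ι, I.card = k → ‖∑ i ∈ I, x i‖ ≤ 1) :
    Fintype.card ι ∈ collapsingSizes k X := by
  let e := (Fintype.equivFin ι).symm
  refine ⟨fun i => x (e i), fun i => hx _, fun I hI => ?_⟩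
  have h := hc (I.map e.toEmbedding) (by simpa using hI)
  simpa using h

/-- The vectors `±e_a`: every subset sum has coordinates in `{-1, 0, 1}`. -/
theorem two_mul_mem_collapsingSizes (k d : ℕ) :
    2 * d ∈ collapsingSizes k (ULift.{u} (Fin d) → ℝ) := by
  classical
  have h := card_mem_collapsingSizes (k := k) (X := ULift.{u} (Fin d) → ℝ)
    (fun z : Fin 2 × ULift.{u} (Fin d) => Pi.single z.2 ((-1 : ℝ) ^ (z.1 : ℕ))) ?_ ?_
  · simpa using h
  · rintro ⟨i, a⟩
    refine le_trans ?_ (norm_le_pi_norm _ a)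
    simp
  · intro I _
    rw [pi_norm_le_iff_of_nonneg zero_le_one]
    intro a
    have hsum : (∑ z ∈ I, (Pi.single z.2 ((-1 : ℝ) ^ (z.1 : ℕ)) : ULift.{u} (Fin d) → ℝ)) a =
        (if ((0 : Fin 2), a) ∈ I then (1 : ℝ) else 0) +
          (if ((1 : Fin 2), a) ∈ I then (-1 : ℝ) else 0) := by
      rw [Finset.sum_apply, ← Finset.sum_ite_mem_eq I, Fintype.sum_prod_type, Fin.sum_univ_two]
      congr 1
      · rw [Finset.sum_eq_single_of_mem a (Finset.mem_univ _)]
        · simp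
        · intro b _ hb
          simp [hb.symm]
      · rw [Finset.sum_eq_single_of_mem a (Finset.mem_univ _)]
        · simp
        · intro b _ hb
          simp [hb.symm]
    rw [hsum]
    split_ifs <;> norm_num

/-- When `k + 1` vectors sum to zero, each `k`-sum is the negative of the omitted vector, so unit
vectors with zero sum suffice. Two coordinates provide them: `(1, -s)` and the vectors `(-1/k, ±1)`
with alternating signs. -/
theorem succ_mem_collapsingSizes (k : ℕ) {d : ℕ} (hk : 1 ≤ k) (hd : 2 ≤ d) :
    k + 1 ∈ collapsingSizes k (ULift.{u} (Fin d) → ℝ) := by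
  classical
  let a₀ : ULift.{u} (Fin d) := ⟨⟨0, by omega⟩⟩
  let a₁ : ULift.{u} (Fin d) := ⟨⟨1, by omega⟩⟩
  have hne : a₀ ≠ a₁ := by simp [a₀, a₁]
  let s : ℝ := ∑ j : Fin k, (-1) ^ (j : ℕ)
  have hs : |s| ≤ 1 := by
    simp only [s]
    rw [Fin.sum_univ_eq_sum_range (fun j => (-1 : ℝ) ^ j), neg_one_geom_sum]
    split_ifs <;> simp
  have hk' : (1 : ℝ) ≤ k := by exact_mod_cast hk
  have hk1 : |(k : ℝ)⁻¹| ≤ 1 := by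
    rw [abs_of_nonneg (by positivity)]
    exact inv_le_one_of_one_le₀ hk'
  let v (α β : ℝ) : ULift.{u} (Fin d) → ℝ := Pi.single a₀ α + Pi.single a₁ β
  have hv0 (α β : ℝ) : v α β a₀ = α := by simp [v, hne]
  have hv1 (α β : ℝ) : v α β a₁ = β := by simp [v, hne.symm]
  have hvle (α β : ℝ) (hα : |α| ≤ 1) (hβ : |β| ≤ 1) : ‖v α β‖ ≤ 1 := by
    rw [pi_norm_le_iff_of_nonneg zero_le_one]
    intro a
    by_cases h0 : a = a₀
    · rw [h0, hv0]
      exact hα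
    · by_cases h1 : a = a₁
      · rw [h1, hv1]
        exact hβ
      · simp [v, h0, h1]
  let x : Fin (k + 1) → ULift.{u} (Fin d) → ℝ :=
    Fin.cons (v 1 (-s)) fun j => v (-(k : ℝ)⁻¹) ((-1) ^ (j : ℕ))
  have hsum : ∑ i, x i = 0 := by
    rw [Fin.sum_univ_succ]
    simp only [x, Fin.cons_zero, Fin.cons_succ]
    have h : ∑ j : Fin k, v (-(k : ℝ)⁻¹) ((-1) ^ (j : ℕ)) = v (-1) s := by
      simp only [v, Finset.sum_add_distrib, s]
      congr 1
      · rw [Finset.sum_const, Finset.card_univ, Fintype.card_fin, ← Pi.single_smul]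
        congr 1
        simp
        field_simp
      · ext a
        rw [Finset.sum_apply]
        by_cases h : a = a₁ <;> simp [h]
    rw [h]
    simp only [v, Pi.single_neg]
    abel
  refine ⟨x, fun i => ?_, fun I hI => ?_⟩
  · refine Fin.cases ?_ (fun j => ?_) i
    · refine le_trans ?_ (norm_le_pi_norm (x 0) a₀)
      simp [x, hv0]
    · refine le_trans ?_ (norm_le_pi_norm (x j.succ) a₁)
      simp [x, hv1]
  · have hcard : Iᶜ.card = 1 := by
      rw [Finset.card_compl, hI]
      simp
    obtain ⟨i, hi⟩ := Finset.card_eq_one.1 hcard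
    have h := Finset.sum_add_sum_compl I x
    rw [hi, Finset.sum_singleton, hsum] at h
    rw [eq_neg_of_add_eq_zero_left h, norm_neg]
    refine Fin.cases ?_ (fun j => ?_) i
    · exact hvle _ _ (by simp) (by simpa using hs)
    · exact hvle _ _ (by simpa using hk1) (by simp)

/-! ### Assembly of the bounds -/

theorem maxCollapsingNumber_eq_of_not_isCollapsing {k d : ℕ} (hk : 1 ≤ k) (hd : 2 ≤ d)
    (h : ∀ (X : Type u) [NormedAddCommGroup X] [NormedSpace ℝ X] [FiniteDimensional ℝ X],
      Module.finrank ℝ X = d → ∀ x : Fin (max (k + 1) (2 * d) + 1) → X, (∀ i, 1 ≤ ‖x i‖) →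
        ¬IsCollapsing k x) :
    maxCollapsingNumber.{u} k d = ((max (k + 1) (2 * d) : ℕ) : ℕ∞) := by
  refine le_antisymm (sSup_le ?_) ?_
  · rintro _ ⟨X, _, _, _, hX, rfl⟩
    refine sSup_le ?_
    rintro _ ⟨m, ⟨x, hx, hc⟩, rfl⟩
    by_contra! hlt
    have hm : max (k + 1) (2 * d) + 1 ≤ m := by exact_mod_cast hlt
    refine h X hX (fun i => x (Fin.castLE hm i)) (fun i => hx _) fun I hI => ?_
    have := hc (I.map (Fin.castLEEmb hm)) (by simpa using hI)
    simpa using this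
  · have hmem : max (k + 1) (2 * d) ∈ collapsingSizes k (ULift.{u} (Fin d) → ℝ) := by
      rcases max_choice (k + 1) (2 * d) with h | h <;> rw [h]
      · exact succ_mem_collapsingSizes k hk hd
      · exact two_mul_mem_collapsingSizes k d
    refine le_trans (le_sSup ⟨_, hmem, rfl⟩ :
      _ ≤ collapsingNumber k (ULift.{u} (Fin d) → ℝ)) ?_
    exact le_sSup ⟨_, inferInstance, inferInstance, inferInstance, by simp, rfl⟩

theorem theorem1p14 (k d : ℕ)
    (h : (d = 2 ∧ 2 ≤ k) ∨
      ((d = 3 ∨ d = 4 ∨ d = 5) ∧ 3 ≤ k) ∨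
      (d = 6 ∧ ((3 ≤ k ∧ k ≤ 10) ∨ 17 ≤ k)) ∨
      (d = 7 ∧ ((3 ≤ k ∧ k ≤ 12) ∨ 41 ≤ k))) :
    maxCollapsingNumber.{u} k d = ((max (k + 1) (2 * d) : ℕ) : ℕ∞) := by
  refine maxCollapsingNumber_eq_of_not_isCollapsing (by omega) (by omega) ?_
  intro X _ _ _ hX
  by_cases hkd : k ≤ 2 * d - 2
  · rw [max_eq_right (by omega)]
    exact fun x hx => not_isCollapsing_of_le hX (by omega) (by omega) hkd (by omega) hx
  · rw [max_eq_left (by omega)]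
    refine fun x hx => not_isCollapsing_of_lt hX (by omega) (by omega) ?_ hx
    have hd : d = 2 ∨ d = 3 ∨ d = 4 ∨ d = 5 ∨ d = 6 ∨ d = 7 := by omega
    -- The inequality to prove becomes `k ^ 2 - 18 k + 29 > 0` for `d = 6` and `k ^ 2 - 42 k + 73 >
    -- 0` for `d = 7`; beyond the larger roots these hold from 17 and 41 on.
    obtain ⟨e, he, hke⟩ : ∃ e : ℤ, e ≤ k ∧
        e = if d = 7 then 41 else if d = 6 then 17 else 2 * d - 1 :=
      ⟨_, by split_ifs <;> omega, rfl⟩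
    rcases hd with rfl | rfl | rfl | rfl | rfl | rfl <;> norm_num at hke ⊢ <;> subst hke <;>
      nlinarith
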